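/- A transcendental entire function is a holomorphic function $g:\mathbb{C}\to\mathbb{C}$ that is not a polynomial; $g^n$ denotes its $n$-th iterate. A family of holomorphic functions is normal on a domain $V\subset\mathbb{C}$ if every sequence in it has a subsequence converging locally uniformly on $V$ either to a holomorphic function or to $\infty$. The Fatou set $F(g)$ is the set of all $z\in\mathbb{C}$ having an open connected neighbourhood on which $\{g^n : n\in\mathbb{N}\}$ is normal. For a connected component $U$ of $F(g)$ let $U_k$ be the component of $F(g)$ containing $g^k(U)$. The component $U$ is a wandering domain of $g$ if $U_k\cap U_l=\emptyset$ for all $k\neq l$. It is a Baker domain of $g$ if there is $k\geq 1$ with $U_k=U$ (that is, $g^k(U)\subset U$) such that $g^{nk}(z)\to\infty$ as $n\to\infty$ for every $z\in U$. Theorem. Let $g$ and $h$ be transcendental entire functions, and let $f:\mathbb{C}\to\mathbb{C}$ be a continuous open map with $f\circ g=h\circ f$. If $g$ has neither wandering domains nor Baker domains, then $f(F(g))\subset F(h)$. -/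

import Mathlib

open Set Filter Topology

namespace EntireDynamics

/-- A transcendental entire function: holomorphic on all of `ℂ` and not a polynomial. -/
def IsTranscendentalEntire (g : ℂ → ℂ) : Prop :=
  Differentiable ℂ g ∧ ¬ ∃ p : Polynomial ℂ, ∀ z, g z = p.eval z

/-- The sequence `F` converges to `∞` locally uniformly (that is, uniformly on compact
subsets) on `V`. -/
def TendstoInftyLocallyUniformlyOn (F : ℕ → ℂ → ℂ) (V : Set ℂ) : Prop :=
  ∀ K ⊆ V, IsCompact K → ∀ M : ℝ, ∀ᶠ n in atTop, ∀ z ∈ K, M < ‖F n z‖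

/-- Normality (in the sense of Montel) of a family `𝓕` of holomorphic functions on a domain
(a connected open set) `V`: every sequence in `𝓕` has a subsequence which converges locally
uniformly on `V`, either to a holomorphic function or to `∞`. -/
def IsNormalFamilyOn (𝓕 : Set (ℂ → ℂ)) (V : Set ℂ) : Prop :=
  ∀ F : ℕ → ℂ → ℂ, (∀ n, F n ∈ 𝓕) → ∃ φ : ℕ → ℕ, StrictMono φ ∧
    ((∃ G : ℂ → ℂ, DifferentiableOn ℂ G V ∧
        TendstoLocallyUniformlyOn (fun n => F (φ n)) G atTop V) ∨
      TendstoInftyLocallyUniformlyOn (fun n => F (φ n)) V)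

/-- The Fatou set of `g`: the points with an (open, connected) neighbourhood on which the
family of iterates of `g` is normal. -/
def fatouSet (g : ℂ → ℂ) : Set ℂ :=
  {z | ∃ V : Set ℂ, IsOpen V ∧ IsConnected V ∧ z ∈ V ∧
    IsNormalFamilyOn (range fun n : ℕ => g^[n]) V}

/-- `U` is a connected component of the Fatou set of `g`. -/
def IsFatouComponent (g : ℂ → ℂ) (U : Set ℂ) : Prop :=
  ∃ z ∈ fatouSet g, U = connectedComponentIn (fatouSet g) z

/-- `U` is a wandering domain of `g`: a component of the Fatou set such that the components
`W k` of the Fatou set which contain `g^k(U)`, `k = 0, 1, 2, …`, are pairwise disjoint. -/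
def IsWanderingDomain (g : ℂ → ℂ) (U : Set ℂ) : Prop :=
  IsFatouComponent g U ∧ ∃ W : ℕ → Set ℂ,
    (∀ k, IsFatouComponent g (W k) ∧ g^[k] '' U ⊆ W k) ∧
    ∀ k l, k ≠ l → Disjoint (W k) (W l)

/-- `U` is a Baker domain of `g`: a periodic component of the Fatou set (for some `k ≥ 1` the
component containing `g^k(U)` is `U` itself) on which `g^{nk}(z) → ∞` as `n → ∞`. -/
def IsBakerDomain (g : ℂ → ℂ) (U : Set ℂ) : Prop :=
  IsFatouComponent g U ∧ ∃ k : ℕ, 0 < k ∧ g^[k] '' U ⊆ U ∧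
    ∀ z ∈ U, Tendsto (fun n : ℕ => ‖g^[n * k] z‖) atTop atTop

end EntireDynamics

namespace EntireDynamics

/-! If the `g`-orbits of all points near `z` stay in one compact set `S`, then, since `f` is open
and `h^n ∘ f = f ∘ g^n`, the iterates of `h` map a neighbourhood of `f z` into the compact set
`f(S)`, and Montel's theorem puts `f z` in the Fatou set of `h`.

Such an `S` exists (`exists_compact_orbits`): without wandering domains the component of `z` is
eventually periodic, and without Baker domains some orbit under the return map `G = g^p` does not
escape. The core, `eventually_bounded_of_not_escaping`, makes the iterates of `G` locally bounded
without classifying periodic components. Suppose no orbit is bounded. Then no point is recurrent, so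
all finite limit functions are constant. A non-escaping orbit crosses a suitable circle infinitely
often, and a limit of the crossings is a fixed point on that circle, which was chosen to carry none.
-/

/-! ### Normality and equicontinuity of iterates -/

/-- Every point of an open set of normality has a ball on which every sequence of iterates has a
convergent subsequence. -/
theorem exists_ball_normal {G : ℂ → ℂ} {U : Set ℂ} (hU : IsOpen U) (hUF : U ⊆ fatouSet G)
    {z : ℂ} (hz : z ∈ U) :
    ∃ r > 0, Metric.ball z r ⊆ U ∧ IsNormalFamilyOn (range fun n : ℕ => G^[n]) (Metric.ball z r) := by
  obtain ⟨V, hVo, -, hzV, hV⟩ := hUF hz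
  obtain ⟨r, hr, hrV⟩ := Metric.isOpen_iff.1 (hVo.inter hU) z ⟨hzV, hz⟩
  refine ⟨r, hr, fun x hx => (hrV hx).2, fun F hF => ?_⟩
  have hsub : Metric.ball z r ⊆ V := fun x hx => (hrV hx).1
  obtain ⟨φ, hφ, ⟨Φ, h1, h2⟩ | h⟩ := hV F hF
  · exact ⟨φ, hφ, Or.inl ⟨Φ, h1.mono hsub, h2.mono hsub⟩⟩
  · exact ⟨φ, hφ, Or.inr fun K hK => h K (hK.trans hsub)⟩

theorem IsNormalFamilyOn.subseq_iterate {G : ℂ → ℂ} {V : Set ℂ}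
    (hV : IsNormalFamilyOn (range fun n : ℕ => G^[n]) V) (m : ℕ → ℕ) :
    ∃ φ : ℕ → ℕ, StrictMono φ ∧
    ((∃ Φ : ℂ → ℂ, DifferentiableOn ℂ Φ V ∧
        TendstoLocallyUniformlyOn (fun n => G^[m (φ n)]) Φ atTop V) ∨
      TendstoInftyLocallyUniformlyOn (fun n => G^[m (φ n)]) V) :=
  hV (fun n => G^[m n]) fun n => ⟨m n, rfl⟩

/-- If one orbit starting in a domain of normality is bounded, then the iterates are locally
bounded there. -/
theorem IsNormalFamilyOn.eventually_bounded {G : ℂ → ℂ} {V : Set ℂ}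
    (hVo : IsOpen V) (hV : IsNormalFamilyOn (range fun n : ℕ => G^[n]) V) {x y : ℂ}
    (hx : x ∈ V) (hy : y ∈ V) {M : ℝ} (hM : ∀ n, ‖G^[n] x‖ ≤ M) :
    ∃ C : ℝ, ∀ᶠ u in 𝓝 y, ∀ n, ‖G^[n] u‖ ≤ C := by
  obtain ⟨r, hr, hrV⟩ := Metric.nhds_basis_closedBall.mem_iff.1 (hVo.mem_nhds hy)
  by_contra! hcon
  have hbad : ∀ k : ℕ, ∃ n, ∃ u ∈ Metric.closedBall y r, (k : ℝ) < ‖G^[n] u‖ := by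
    intro k
    by_contra! h
    exact hcon k (eventually_of_mem (Metric.closedBall_mem_nhds y hr) fun u hu ⟨n, hn⟩ =>
      (h n u hu).not_gt hn)
  choose m u hu hmu using hbad
  obtain ⟨φ, hφ, ⟨Φ, h1, h2⟩ | h⟩ := hV.subseq_iterate m
  · have hK := isCompact_closedBall y r
    obtain ⟨C, hC⟩ := hK.exists_bound_of_continuousOn (h1.continuousOn.mono hrV)
    have h3 := (tendstoLocallyUniformlyOn_iff_tendstoUniformlyOn_of_compact hK).1 (h2.mono hrV)
    have h4 := Metric.tendstoUniformlyOn_iff.1 h3 1 one_pos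
    obtain ⟨N, hN⟩ := exists_nat_gt (C + 1)
    obtain ⟨j, hj, hjN⟩ := (h4.and (eventually_ge_atTop N)).exists
    have h5 := hj _ (hu (φ j))
    have h6 := hC _ (hu (φ j))
    have h7 := hmu (φ j)
    have h8 : (N : ℝ) ≤ φ j := by exact_mod_cast hjN.trans (hφ.id_le j)
    rw [dist_comm, dist_eq_norm] at h5
    have h9 := norm_le_norm_add_norm_sub' (G^[m (φ j)] (u (φ j))) (Φ (u (φ j)))
    linarith
  · obtain ⟨j, hj⟩ := (h {x} (singleton_subset_iff.2 hx) isCompact_singleton M).exists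
    exact absurd (hM _) (not_le.2 (hj x rfl))

/-- Equicontinuity of the iterates at a Fatou point, for sequences with a finite limit. -/
theorem tendsto_iterate_of_tendsto {G : ℂ → ℂ} {w y : ℂ} (hw : w ∈ fatouSet G) {x : ℕ → ℂ}
    (hx : Tendsto x atTop (𝓝 w)) {n : ℕ → ℕ}
    (hn : Tendsto (fun j => G^[n j] (x j)) atTop (𝓝 y)) :
    Tendsto (fun j => G^[n j] w) atTop (𝓝 y) := by
  obtain ⟨V, hVo, -, hwV, hV⟩ := hw
  refine tendsto_of_subseq_tendsto fun ns hns => ?_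
  obtain ⟨φ, hφ, ⟨Φ, h1, h2⟩ | h⟩ := hV.subseq_iterate (fun j => n (ns j))
  · refine ⟨φ, ?_⟩
    have hlim : Tendsto (fun j => ns (φ j)) atTop atTop := hns.comp hφ.tendsto_atTop
    have h3 := h2.tendsto_comp (h1.continuousOn w hwV) hwV
      (tendsto_nhdsWithin_iff.2 ⟨hx.comp hlim, (hx.comp hlim).eventually (hVo.mem_nhds hwV)⟩)
    rw [← tendsto_nhds_unique h3 (hn.comp hlim)]
    exact h2.tendsto_at hwV
  · exfalso
    obtain ⟨r, hr, hrV⟩ := Metric.nhds_basis_closedBall.mem_iff.1 (hVo.mem_nhds hwV)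
    have hlim : Tendsto (fun j => ns (φ j)) atTop atTop := hns.comp hφ.tendsto_atTop
    have h1 := h _ hrV (isCompact_closedBall w r) (‖y‖ + 1)
    have h2 := (hx.comp hlim).eventually (Metric.closedBall_mem_nhds w hr)
    have h3 := (hn.comp hlim).norm.eventually (gt_mem_nhds (lt_add_one ‖y‖))
    obtain ⟨j, hj1, hj2, hj3⟩ := (h1.and (h2.and h3)).exists
    exact lt_asymm hj3 (hj1 _ hj2)

/-! ### Recurrent points and constant limit functions -/

/-- A recurrent point of the Fatou set of a continuous map has a bounded orbit. -/
theorem exists_bound_of_recurrent {G : ℂ → ℂ} (hG : Continuous G) {U : Set ℂ} (hU : IsOpen U)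
    (hUF : U ⊆ fatouSet G) {w : ℂ} (hw : w ∈ U) {q : ℕ → ℕ} (hq : Tendsto q atTop atTop)
    (hrec : Tendsto (fun j => G^[q j] w) atTop (𝓝 w)) : ∃ M : ℝ, ∀ n, ‖G^[n] w‖ ≤ M := by
  obtain ⟨r, hr, hrU⟩ := Metric.nhds_basis_closedBall.mem_iff.1 (hU.mem_nhds hw)
  set B := Metric.closedBall w r with hB
  have hBc : IsCompact B := isCompact_closedBall w r
  set Q := B ∩ closure (range fun n => G^[n] w) with hQ
  have hQc : IsCompact Q := hBc.inter_right isClosed_closure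
  -- Orbit points approximating `y` later come back near `w`; equicontinuity at `y` transfers these
  -- returns to `y`.
  have hret : ∀ y ∈ Q, ∃ n, 1 ≤ n ∧ G^[n] y ∈ Metric.ball w r := by
    rintro y ⟨hyB, hy⟩
    obtain ⟨x, hx, hxy⟩ := mem_closure_iff_seq_limit.1 hy
    choose n hn using hx
    have hj : ∀ i : ℕ, ∃ j, i ≤ j ∧ n i + 1 ≤ q j := fun i =>
      ((eventually_ge_atTop i).and (hq.eventually (eventually_ge_atTop (n i + 1)))).exists
    choose j hij hnj using hj
    have hjt : Tendsto j atTop atTop := tendsto_atTop_mono hij tendsto_id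
    have hlim : Tendsto (fun i => G^[q (j i) - n i] (x i)) atTop (𝓝 w) := by
      refine (hrec.comp hjt).congr fun i => ?_
      have := hn i
      simp only [Function.comp_apply] at this ⊢
      rw [← this, ← Function.iterate_add_apply, Nat.sub_add_cancel (by have := hnj i; omega)]
    have h := tendsto_iterate_of_tendsto (hUF (hrU hyB)) hxy hlim
    obtain ⟨i, hi⟩ := (h.eventually (Metric.ball_mem_nhds w hr)).exists
    exact ⟨_, by have := hnj i; omega, hi⟩
  obtain ⟨t, ht⟩ := hQc.elim_finite_subcover
    (fun n : ℕ => {y | G^[n + 1] y ∈ Metric.ball w r})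
    (fun n => Metric.isOpen_ball.preimage (hG.iterate (n + 1)))
    (fun y hy => by
      obtain ⟨n, hn1, hn⟩ := hret y hy
      exact mem_iUnion.2 ⟨n - 1, by simpa [Nat.sub_add_cancel hn1] using hn⟩)
  obtain ⟨N, hN⟩ := t.exists_le
  -- Return times on `Q` are at most `N + 1`, so at any time some visit to `B` lies at most `N`
  -- steps back.
  have key : ∀ n, ∃ k ≤ N, k ≤ n ∧ G^[n - k] w ∈ B := by
    intro n
    induction n with
    | zero => exact ⟨0, Nat.zero_le _, le_rfl, by simp [hB, hr.le]⟩
    | succ n ih =>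
      obtain ⟨k, hkN, hkn, hk⟩ := ih
      rcases hkN.lt_or_eq with hlt | rfl
      · exact ⟨k + 1, hlt, by omega, by rwa [Nat.add_sub_add_right]⟩
      · obtain ⟨s, hst, hs⟩ := mem_iUnion₂.1 (ht ⟨hk, subset_closure ⟨n - k, rfl⟩⟩)
        have hsN := hN s hst
        refine ⟨k - s, by omega, by omega, ?_⟩
        have e : n + 1 - (k - s) = (s + 1) + (n - k) := by omega
        rw [e, Function.iterate_add_apply]
        exact Metric.ball_subset_closedBall hs
  have hcpt : IsCompact (⋃ k ∈ Finset.range (N + 1), G^[k] '' B) :=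
    (Finset.range (N + 1)).isCompact_biUnion fun k _ => hBc.image (hG.iterate k)
  obtain ⟨M, hM⟩ := hcpt.isBounded.exists_norm_le
  refine ⟨M, fun n => hM _ ?_⟩
  obtain ⟨k, hkN, hkn, hk⟩ := key n
  refine mem_iUnion₂.2 ⟨k, Finset.mem_range.2 (by omega), _, hk, ?_⟩
  rw [← Function.iterate_add_apply, Nat.add_sub_cancel' hkn]

/-- If the iterates `G^[m j]` converge to `w` at a point and `w` is in the Fatou set, then `w` is
recurrent. -/
theorem tendsto_iterate_self {G : ℂ → ℂ} {z w : ℂ} (hw : w ∈ fatouSet G) {m : ℕ → ℕ}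
    (hm : StrictMono m) (h : Tendsto (fun j => G^[m j] z) atTop (𝓝 w)) :
    ∃ q : ℕ → ℕ, Tendsto q atTop atTop ∧ Tendsto (fun j => G^[q j] w) atTop (𝓝 w) := by
  have hgap : ∀ a b : ℕ, m a + b ≤ m (a + b) := fun a b => by
    induction b with
    | zero => simp
    | succ b ih =>
      have : m (a + b) < m (a + (b + 1)) := hm (by omega)
      omega
  have h2 : Tendsto (fun j : ℕ => j + j) atTop atTop :=
    tendsto_atTop_mono (fun j => Nat.le_add_left j j) tendsto_id
  -- `G^[q j]` carries `G^[m j] z` to `G^[m (j + j)] z`, and both tend to `w`.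
  refine ⟨fun j => m (j + j) - m j, tendsto_atTop_mono (fun j => ?_) tendsto_id,
    tendsto_iterate_of_tendsto hw h ((h.comp h2).congr fun j => ?_)⟩
  · have := hgap j j; simp; omega
  · rw [← Function.iterate_add_apply, Nat.sub_add_cancel (hm.monotone (Nat.le_add_left j j))]
    rfl

/-- In an invariant open set without recurrent points, all limit functions are constant. -/
theorem tendsto_iterate_const {G : ℂ → ℂ} {U : Set ℂ}
    (hU : IsOpen U) (hUc : IsPreconnected U) (hUF : U ⊆ fatouSet G) (hGU : MapsTo G U U)
    (hrec : ∀ w ∈ U, ∀ q : ℕ → ℕ, Tendsto q atTop atTop →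
      ¬ Tendsto (fun j => G^[q j] w) atTop (𝓝 w))
    {m : ℕ → ℕ} (hm : StrictMono m) {c z y : ℂ} (hz : z ∈ U) (hy : y ∈ U)
    (hc : Tendsto (fun j => G^[m j] z) atTop (𝓝 c)) :
    Tendsto (fun j => G^[m j] y) atTop (𝓝 c) := by
  suffices H : Tendsto (fun j => G^[m j] z) atTop (𝓝 c) ↔ Tendsto (fun j => G^[m j] y) atTop (𝓝 c)
    from H.1 hc
  refine hUc.induction₂ (fun z y => Tendsto (fun j => G^[m j] z) atTop (𝓝 c) ↔
    Tendsto (fun j => G^[m j] y) atTop (𝓝 c)) (fun x hx => ?_) (fun _ _ _ _ _ _ => Iff.trans)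
    (fun _ _ _ _ => Iff.symm) hz hy
  obtain ⟨r, hr, hrU, hV⟩ := exists_ball_normal hU hUF hx
  have key : ∀ a ∈ Metric.ball x r, ∀ b ∈ Metric.ball x r,
      Tendsto (fun j => G^[m j] a) atTop (𝓝 c) → Tendsto (fun j => G^[m j] b) atTop (𝓝 c) := by
    intro a ha b hb hac
    refine tendsto_of_subseq_tendsto fun ns hns => ?_
    obtain ⟨ψ, hψ, hnψ⟩ := strictMono_subseq_of_tendsto_atTop hns
    obtain ⟨φ, hφ, ⟨Φ, h1, h2⟩ | h⟩ := hV.subseq_iterate (fun j => m (ns (ψ j)))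
    · refine ⟨fun j => ψ (φ j), ?_⟩
      have hsm : StrictMono fun j => m (ns (ψ (φ j))) := hm.comp (hnψ.comp hφ)
      have hlim : Tendsto (fun j => ns (ψ (φ j))) atTop atTop := (hnψ.comp hφ).tendsto_atTop
      have hΦa : Φ a = c := tendsto_nhds_unique (h2.tendsto_at ha) (hac.comp hlim)
      rcases (h1.analyticOnNhd Metric.isOpen_ball).is_constant_or_isOpen
        (convex_ball x r).isPreconnected with ⟨d, hd⟩ | hop
      · have hbc : Φ b = c := by rw [hd b hb, ← hd a ha, hΦa]
        rw [← hbc]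
        exact h2.tendsto_at hb
      -- A nonconstant limit is open and takes the value `c` in the closure of `U`, so it also takes
      -- a value in `U`, which would be recurrent.
      · exfalso
        have hO := hop _ subset_rfl Metric.isOpen_ball
        have hcl : c ∈ closure U := by
          rw [← hΦa]
          exact mem_closure_of_tendsto (h2.tendsto_at ha)
            (Eventually.of_forall fun j => hGU.iterate _ (hrU ha))
        obtain ⟨w, ⟨v, hv, rfl⟩, hwU⟩ := mem_closure_iff.1 hcl _ hO ⟨a, ha, hΦa⟩
        obtain ⟨q, hq, hqw⟩ := tendsto_iterate_self (hUF hwU) hsm (h2.tendsto_at hv)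
        exact hrec _ hwU q hq hqw
    · exfalso
      have h1 := h {a} (singleton_subset_iff.2 ha) isCompact_singleton (‖c‖ + 1)
      have hlim : Tendsto (fun j => ns (ψ (φ j))) atTop atTop := (hnψ.comp hφ).tendsto_atTop
      have h3 := (hac.comp hlim).norm.eventually (gt_mem_nhds (lt_add_one ‖c‖))
      obtain ⟨j, hj1, hj3⟩ := (h1.and h3).exists
      exact lt_asymm hj3 (hj1 _ rfl)
  filter_upwards [mem_nhdsWithin_of_mem_nhds (Metric.ball_mem_nhds x hr)] with b hb
  exact ⟨key x (Metric.mem_ball_self hr) b hb, key b hb x (Metric.mem_ball_self hr)⟩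


/-! ### Escape or local boundedness on an invariant domain -/

/-- An entire function other than the identity has no fixed points on some circle with radius in
any prescribed interval. -/
theorem exists_radius_forall_fixed_ne {G : ℂ → ℂ} (hG : Differentiable ℂ G) {a : ℂ} (ha : G a ≠ a)
    (R₀ : ℝ) : ∃ R, R₀ < R ∧ ∀ c, G c = c → ‖c‖ ≠ R := by
  have han : AnalyticOnNhd ℂ (fun z => G z - z) univ :=
    (hG.sub differentiable_id).differentiableOn.analyticOnNhd isOpen_univ
  have hcod := han.preimage_zero_mem_codiscrete (x := a) (sub_ne_zero.2 ha)
  have hK := isCompact_closedBall (0 : ℂ) (R₀ + 1)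
  have hfin := hK.finite_sdiff_of_mem_codiscreteWithin
    (codiscreteWithin_mono (subset_univ _) hcod)
  obtain ⟨R, ⟨hR1, hR2⟩, hR⟩ :=
    (Ioo_infinite (lt_add_one R₀)).exists_notMem_finite (hfin.image norm)
  refine ⟨R, hR1, fun c hc hcR => hR ⟨c, ⟨?_, ?_⟩, hcR⟩⟩
  · simpa using hcR.le.trans hR2.le
  · simp [hc]

theorem exists_frequently_crossing {a : ℕ → ℝ} {R : ℝ} (h1 : ∃ᶠ n in atTop, a n ≤ R)
    (h2 : ∃ᶠ n in atTop, R < a n) : ∃ᶠ n in atTop, a n ≤ R ∧ R < a (n + 1) := by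
  rw [frequently_atTop] at *
  intro N
  obtain ⟨n, hn, hnR⟩ := h1 N
  obtain ⟨m, hm, hmR⟩ := h2 n
  by_contra! hcon
  have : ∀ k, n ≤ k → a k ≤ R := fun k hk =>
    Nat.le_induction hnR (fun j hj ih => hcon j (hn.trans hj) ih) k hk
  exact absurd (this m hm) (not_le.2 hmR)

/-- If the iterates of an entire function do not tend to infinity at some point of an invariant
domain of normality, then they are locally bounded on this domain. -/
theorem eventually_bounded_of_not_escaping {G : ℂ → ℂ} (hG : Differentiable ℂ G) {U : Set ℂ}
    (hU : IsOpen U) (hUc : IsPreconnected U) (hUF : U ⊆ fatouSet G) (hGU : MapsTo G U U)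
    {z : ℂ} (hz : z ∈ U) (hesc : ¬ Tendsto (fun n => ‖G^[n] z‖) atTop atTop) {y : ℂ} (hy : y ∈ U) :
    ∃ C : ℝ, ∀ᶠ u in 𝓝 y, ∀ n, ‖G^[n] u‖ ≤ C := by
  have htrans : ∀ v ∈ U, ∀ x ∈ U, (∃ M : ℝ, ∀ n, ‖G^[n] v‖ ≤ M) →
      ∃ C : ℝ, ∀ᶠ u in 𝓝 x, ∀ n, ‖G^[n] u‖ ≤ C := by
    intro v hv x hx hM
    have hball : ∀ x ∈ U, ∃ r > 0, ∀ a ∈ Metric.ball x r, ∀ b ∈ Metric.ball x r,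
        (∃ M : ℝ, ∀ n, ‖G^[n] a‖ ≤ M) → ∃ C : ℝ, ∀ᶠ u in 𝓝 b, ∀ n, ‖G^[n] u‖ ≤ C := by
      intro x hx
      obtain ⟨r, hr, -, hV⟩ := exists_ball_normal hU hUF hx
      exact ⟨r, hr, fun a ha b hb ⟨M, hM⟩ => hV.eventually_bounded Metric.isOpen_ball ha hb hM⟩
    have hself : ∀ x, (∃ C : ℝ, ∀ᶠ u in 𝓝 x, ∀ n, ‖G^[n] u‖ ≤ C) → ∃ M : ℝ, ∀ n, ‖G^[n] x‖ ≤ M :=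
      fun x ⟨C, hC⟩ => ⟨C, hC.self_of_nhds⟩
    have hiff : (∃ M : ℝ, ∀ n, ‖G^[n] v‖ ≤ M) ↔ ∃ M : ℝ, ∀ n, ‖G^[n] x‖ ≤ M := by
      refine hUc.induction₂ (fun v x => (∃ M : ℝ, ∀ n, ‖G^[n] v‖ ≤ M) ↔ ∃ M : ℝ, ∀ n, ‖G^[n] x‖ ≤ M)
        (fun x hx => ?_) (fun _ _ _ _ _ _ => Iff.trans) (fun _ _ _ _ => Iff.symm) hv hx
      obtain ⟨r, hr, h⟩ := hball x hx
      filter_upwards [mem_nhdsWithin_of_mem_nhds (Metric.ball_mem_nhds x hr)] with b hb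
      exact ⟨fun H => hself _ (h x (Metric.mem_ball_self hr) b hb H),
        fun H => hself _ (h b hb x (Metric.mem_ball_self hr) H)⟩
    obtain ⟨r, hr, h⟩ := hball x hx
    exact h x (Metric.mem_ball_self hr) x (Metric.mem_ball_self hr) (hiff.1 hM)
  suffices H : ∃ v ∈ U, ∃ M : ℝ, ∀ n, ‖G^[n] v‖ ≤ M by
    obtain ⟨v, hv, hM⟩ := H
    exact htrans v hv y hy hM
  by_contra! hunb
  have hrec : ∀ w ∈ U, ∀ q : ℕ → ℕ, Tendsto q atTop atTop →
      ¬ Tendsto (fun j => G^[q j] w) atTop (𝓝 w) := by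
    intro w hw q hq hqw
    obtain ⟨M, hM⟩ := exists_bound_of_recurrent hG.continuous hU hUF hw hq hqw
    obtain ⟨n, hn⟩ := hunb w hw M
    exact absurd (hM n) (not_le.2 hn)
  have hfix : G z ≠ z := fun h => by
    obtain ⟨n, hn⟩ := hunb z hz ‖z‖
    rw [Function.iterate_fixed h] at hn
    exact lt_irrefl _ hn
  obtain ⟨R₀, hR₀⟩ : ∃ R₀ : ℝ, ∃ᶠ n in atTop, ‖G^[n] z‖ < R₀ := by
    rw [tendsto_atTop] at hesc
    push Not at hesc
    exact hesc
  obtain ⟨R, hR, hRfix⟩ := exists_radius_forall_fixed_ne hG hfix R₀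
  have hbig : ∃ᶠ n in atTop, R < ‖G^[n] z‖ := by
    rw [frequently_atTop]
    intro N
    by_contra! hcon
    obtain ⟨M, hM⟩ := ((finite_lt_nat N).image fun n => ‖G^[n] z‖).bddAbove
    obtain ⟨n, hn⟩ := hunb z hz (max M R)
    rcases lt_or_ge n N with h | h
    · exact absurd (hM ⟨n, h, rfl⟩) (not_le.2 ((le_max_left _ _).trans_lt hn))
    · exact absurd (hcon n h) (not_le.2 ((le_max_right _ _).trans_lt hn))
  obtain ⟨m, hm, hmR⟩ := extraction_of_frequently_atTop
    (exists_frequently_crossing (hR₀.mono fun n hn => (hn.trans hR).le) hbig)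
  obtain ⟨c, hcB, ψ, hψ, hψc⟩ := (isCompact_closedBall (0 : ℂ) R).tendsto_subseq
    (x := fun j => G^[m j] z) fun j => by simpa using (hmR j).1
  -- Limits being constant, `z` and `G z` share the limit `c`; this forces `G c = c`, and the
  -- crossings force `‖c‖ = R`.
  have hGz : Tendsto (fun j => G^[m (ψ j)] (G z)) atTop (𝓝 c) :=
    tendsto_iterate_const hU hUc hUF hGU hrec (hm.comp hψ) hz (hGU hz) hψc
  have hcR : ‖c‖ = R := by
    refine le_antisymm (by simpa using hcB) (ge_of_tendsto hGz.norm (Eventually.of_forall fun j => ?_))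
    have := (hmR (ψ j)).2
    rw [Function.iterate_succ_apply] at this
    exact this.le
  refine hRfix c (tendsto_nhds_unique (((hG.continuous.tendsto c).comp hψc).congr fun j => ?_) hGz) hcR
  simp only [Function.comp_apply]
  rw [← Function.iterate_succ_apply' G, ← Function.iterate_succ_apply]

/-! ### Montel's theorem and invariance of the Fatou set -/

/-- **Montel's theorem** on a disc: a uniformly bounded family of holomorphic functions is normal
on a smaller concentric disc. -/
theorem isNormalFamilyOn_of_bounded {𝓕 : Set (ℂ → ℂ)} {w : ℂ} {r M : ℝ} (hr : 0 < r)
    (hd : ∀ f ∈ 𝓕, Differentiable ℂ f) (hM : ∀ f ∈ 𝓕, ∀ z ∈ Metric.closedBall w (r + r), ‖f z‖ ≤ M) :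
    IsNormalFamilyOn 𝓕 (Metric.ball w r) := by
  intro F hF
  set K := Metric.closedBall w r with hK
  have hKc : CompactSpace K := isCompact_iff_compactSpace.1 (isCompact_closedBall w r)
  have hM0 : 0 ≤ M := (norm_nonneg _).trans
    (hM _ (hF 0) w (Metric.mem_closedBall_self (by positivity)))
  -- Cauchy's estimate on circles of radius `r`, which stay in the doubled disc.
  have hlip : ∀ n, LipschitzOnWith (Real.toNNReal (M / r)) (F n) K := by
    intro n
    refine (convex_closedBall w r).lipschitzOnWith_of_nnnorm_deriv_le
      (fun x _ => (hd _ (hF n)).differentiableAt) fun x hx => ?_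
    rw [← NNReal.coe_le_coe, coe_nnnorm, Real.coe_toNNReal _ (by positivity)]
    refine Complex.norm_deriv_le_of_forall_mem_sphere_norm_le hr (hd _ (hF n)).diffContOnCl
      fun u hu => hM _ (hF n) u ?_
    rw [Metric.mem_closedBall]
    exact (dist_triangle u x w).trans (add_le_add (le_of_eq hu) hx)
  let A : Set (BoundedContinuousFunction K ℂ) :=
    {f | LipschitzWith (Real.toNNReal (M / r)) f ∧ ∀ x, ‖f x‖ ≤ M}
  let b : ℕ → BoundedContinuousFunction K ℂ := fun n =>
    BoundedContinuousFunction.mkOfCompact ⟨K.domRestrict (F n), (hlip n).continuousOn.domRestrict⟩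
  have hbA : ∀ n, b n ∈ A := fun n => by
    refine ⟨(hlip n).to_restrict, fun x => hM _ (hF n) _ ?_⟩
    exact Metric.closedBall_subset_closedBall (by linarith) x.2
  have hA : IsCompact (closure A) := by
    refine BoundedContinuousFunction.arzela_ascoli (Metric.closedBall 0 M)
      (isCompact_closedBall _ _) A (fun f x hf => by simpa using hf.2 x) ?_
    exact (LipschitzWith.uniformEquicontinuous _ _ fun f : A => f.2.1).equicontinuous
  obtain ⟨Φ, -, φ, hφ, hlim⟩ := hA.tendsto_subseq fun n => subset_closure (hbA n)
  refine ⟨φ, hφ, Or.inl ?_⟩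
  classical
  let Ψ : ℂ → ℂ := fun z => if hz : z ∈ K then Φ ⟨z, hz⟩ else 0
  have hunif : TendstoUniformlyOn (fun n => F (φ n)) Ψ atTop K := by
    rw [tendstoUniformlyOn_iff_tendstoUniformly_comp_coe]
    have h1 := BoundedContinuousFunction.tendsto_iff_tendstoUniformly.1 hlim
    have h2 : Ψ ∘ ((↑) : K → ℂ) = Φ := by
      funext x
      simp [Ψ]
    rw [h2]
    exact h1
  have hloc := (hunif.mono Metric.ball_subset_closedBall).tendstoLocallyUniformlyOn
  exact ⟨Ψ, hloc.differentiableOn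
    (Eventually.of_forall fun n => (hd _ (hF (φ n))).differentiableOn) Metric.isOpen_ball, hloc⟩

theorem mem_fatouSet_of_bounded {h : ℂ → ℂ} (hh : Differentiable ℂ h) {w : ℂ} {M : ℝ}
    (hM : ∀ᶠ z in 𝓝 w, ∀ n, ‖h^[n] z‖ ≤ M) : w ∈ fatouSet h := by
  obtain ⟨R, hR, hsub⟩ := Metric.nhds_basis_closedBall.mem_iff.1 hM
  refine ⟨Metric.ball w (R / 2), Metric.isOpen_ball, Metric.isConnected_ball (by positivity),
    Metric.mem_ball_self (by positivity), isNormalFamilyOn_of_bounded (M := M) (by positivity) ?_ ?_⟩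
  · rintro _ ⟨n, rfl⟩
    exact hh.iterate n
  · rintro _ ⟨n, rfl⟩ z hz
    rw [add_halves] at hz
    exact hsub hz n

theorem isOpen_fatouSet (g : ℂ → ℂ) : IsOpen (fatouSet g) := by
  rw [isOpen_iff_forall_mem_open]
  rintro z ⟨V, hVo, hVc, hz, hV⟩
  exact ⟨V, fun x hx => ⟨V, hVo, hVc, hx, hV⟩, hVo, hz⟩

theorem fatouSet_subset_iterate (g : ℂ → ℂ) (p : ℕ) : fatouSet g ⊆ fatouSet g^[p] := by
  rintro z ⟨V, hVo, hVc, hz, hV⟩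
  refine ⟨V, hVo, hVc, hz, fun F hF => hV F fun n => ?_⟩
  obtain ⟨k, hk⟩ := hF n
  exact ⟨p * k, by rw [← hk]; exact Function.iterate_mul g p k⟩

theorem IsTranscendentalEntire.isOpenMap {g : ℂ → ℂ} (hg : IsTranscendentalEntire g) :
    IsOpenMap g := by
  rcases (hg.1.differentiableOn.analyticOnNhd isOpen_univ).is_constant_or_isOpenMap with ⟨w, hw⟩ | h
  · exact absurd ⟨Polynomial.C w, fun z => by simp [hw]⟩ hg.2
  · exact h

/-- The Fatou set is forward invariant. -/
theorem mapsTo_fatouSet {g : ℂ → ℂ} (hg : Differentiable ℂ g) (hgo : IsOpenMap g) :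
    MapsTo g (fatouSet g) (fatouSet g) := by
  rintro z ⟨V, hVo, -, hz, hV⟩
  obtain ⟨r, hr, hrV⟩ := Metric.nhds_basis_closedBall.mem_iff.1 (hVo.mem_nhds hz)
  have hO : IsOpen (g '' Metric.ball z r) := hgo _ Metric.isOpen_ball
  refine ⟨g '' Metric.ball z r, hO,
    (Metric.isConnected_ball hr).image g hg.continuous.continuousOn,
    mem_image_of_mem g (Metric.mem_ball_self hr), fun F hF => ?_⟩
  choose k hk using hF
  have hk' : ∀ n x, g^[k n + 1] x = F n (g x) := fun n x => by
    rw [Function.iterate_succ_apply, ← hk]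
  have hcpt := isCompact_closedBall z r
  obtain ⟨φ, hφ, ⟨Φ, h1, h2⟩ | h⟩ := hV.subseq_iterate (fun n => k n + 1)
  · refine ⟨φ, hφ, Or.inl ?_⟩
    have h3 := (tendstoLocallyUniformlyOn_iff_tendstoUniformlyOn_of_compact hcpt).1 (h2.mono hrV)
    -- The section `s` need not be continuous: holomorphy of `Φ ∘ s` comes from uniform convergence.
    let s : ℂ → ℂ := Function.invFunOn g (Metric.ball z r)
    have h4 : TendstoLocallyUniformlyOn (fun n => F (φ n)) (Φ ∘ s) atTop (g '' Metric.ball z r) := by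
      refine TendstoUniformlyOn.tendstoLocallyUniformlyOn ?_
      rw [Metric.tendstoUniformlyOn_iff] at h3 ⊢
      intro ε hε
      filter_upwards [h3 ε hε] with n hn y hy
      have := hn (s y) (Metric.ball_subset_closedBall (Function.invFunOn_mem hy))
      rwa [hk', Function.invFunOn_eq hy] at this
    refine ⟨_, h4.differentiableOn (Eventually.of_forall fun n => ?_) hO, h4⟩
    rw [← hk]
    exact (hg.iterate _).differentiableOn
  · refine ⟨φ, hφ, Or.inr fun K hK _ M => ?_⟩
    filter_upwards [h _ hrV hcpt M] with n hn y hy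
    obtain ⟨x, hx, rfl⟩ := hK hy
    rw [← hk']
    exact hn x (Metric.ball_subset_closedBall hx)

/-! ### Compact orbits and the semiconjugacy -/

/-- For a transcendental entire function with neither wandering domains nor Baker domains, the
orbits of the points near a Fatou point stay in a compact set. -/
theorem exists_compact_orbits {g : ℂ → ℂ} (hg : IsTranscendentalEntire g)
    (hw : ¬ ∃ U, IsWanderingDomain g U) (hb : ¬ ∃ U, IsBakerDomain g U) {z : ℂ}
    (hz : z ∈ fatouSet g) : ∃ S : Set ℂ, IsCompact S ∧ ∀ᶠ x in 𝓝 z, ∀ n, g^[n] x ∈ S := by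
  have hc : ∀ n, Continuous g^[n] := hg.1.continuous.iterate
  have hmaps : ∀ n, MapsTo g^[n] (fatouSet g) (fatouSet g) :=
    (mapsTo_fatouSet hg.1 hg.isOpenMap).iterate
  let W : ℕ → Set ℂ := fun k => connectedComponentIn (fatouSet g) (g^[k] z)
  have hsub : ∀ j x, x ∈ fatouSet g → g^[j] '' connectedComponentIn (fatouSet g) x ⊆
      connectedComponentIn (fatouSet g) (g^[j] x) := fun j x hx =>
    (isPreconnected_connectedComponentIn.image _ (hc j).continuousOn).subset_connectedComponentIn
      (mem_image_of_mem _ (mem_connectedComponentIn hx))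
      (((hmaps j).mono_left (connectedComponentIn_subset _ _)).image_subset)
  obtain ⟨k, l, hkl, hkW⟩ : ∃ k l, k < l ∧ ¬ Disjoint (W k) (W l) := by
    by_contra! hcon
    refine hw ⟨W 0, ⟨_, hz, rfl⟩, W, fun k => ⟨⟨_, hmaps k hz, rfl⟩, hsub k z hz⟩, fun k l hkl => ?_⟩
    rcases hkl.lt_or_gt with h | h
    · exact hcon k l h
    · exact (hcon l k h).symm
  have hWeq : W k = W l := by
    obtain ⟨x, hxk, hxl⟩ := not_disjoint_iff.1 hkW
    exact (connectedComponentIn_eq hxk).trans (connectedComponentIn_eq hxl).symm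
  set p := l - k with hp
  have hp0 : 0 < p := by omega
  have hinv : g^[p] '' W k ⊆ W k := by
    have := hsub p _ (hmaps k hz)
    rw [← Function.iterate_add_apply, hp, Nat.sub_add_cancel hkl.le] at this
    exact this.trans hWeq.ge
  obtain ⟨v, hv, hesc⟩ : ∃ v ∈ W k, ¬ Tendsto (fun n => ‖(g^[p])^[n] v‖) atTop atTop := by
    by_contra! hcon
    refine hb ⟨W k, ⟨_, hmaps k hz, rfl⟩, p, hp0, hinv, fun x hx => (hcon x hx).congr fun n => ?_⟩
    rw [mul_comm, Function.iterate_mul]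
  have hWF : W k ⊆ fatouSet g := connectedComponentIn_subset _ _
  obtain ⟨C, hC⟩ := eventually_bounded_of_not_escaping (hg.1.iterate p)
    (isOpen_fatouSet g).connectedComponentIn isPreconnected_connectedComponentIn
    (hWF.trans (fatouSet_subset_iterate g p)) (mapsTo_iff_image_subset.2 hinv) hv hesc
    (mem_connectedComponentIn (hmaps k hz))
  -- The first union covers the preperiod; the second covers later times, split by residue modulo
  -- `p`.
  refine ⟨(⋃ n ∈ Finset.range k, g^[n] '' Metric.closedBall z 1) ∪
      ⋃ n ∈ Finset.range p, g^[n] '' Metric.closedBall 0 C,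
    ((Finset.range k).isCompact_biUnion fun n _ => (isCompact_closedBall z 1).image (hc n)).union
      ((Finset.range p).isCompact_biUnion fun n _ => (isCompact_closedBall 0 C).image (hc n)), ?_⟩
  filter_upwards [((hc k).tendsto z).eventually hC, Metric.closedBall_mem_nhds z one_pos]
    with x hx hx1 n
  rcases lt_or_ge n k with h | h
  · exact Or.inl (mem_iUnion₂.2 ⟨n, Finset.mem_range.2 h, x, hx1, rfl⟩)
  · refine Or.inr (mem_iUnion₂.2 ⟨(n - k) % p, Finset.mem_range.2 (Nat.mod_lt _ hp0),
      (g^[p])^[(n - k) / p] (g^[k] x), by simpa using hx _, ?_⟩)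
    rw [← Function.iterate_mul, ← Function.iterate_add_apply, ← Function.iterate_add_apply,
      Nat.mod_add_div, Nat.sub_add_cancel h]

end EntireDynamics

theorem mainTheorem1 (f g h : ℂ → ℂ)
    (hg : EntireDynamics.IsTranscendentalEntire g)
    (hh : EntireDynamics.IsTranscendentalEntire h)
    (hf : Continuous f) (hf_open : IsOpenMap f)
    (hfgh : f ∘ g = h ∘ f)
    (hg_wandering : ¬ ∃ U : Set ℂ, EntireDynamics.IsWanderingDomain g U)
    (hg_baker : ¬ ∃ U : Set ℂ, EntireDynamics.IsBakerDomain g U) :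
    f '' EntireDynamics.fatouSet g ⊆ EntireDynamics.fatouSet h := by
  rintro _ ⟨z, hz, rfl⟩
  obtain ⟨S, hS, hzS⟩ := EntireDynamics.exists_compact_orbits hg hg_wandering hg_baker hz
  obtain ⟨M, hM⟩ := (hS.image hf).isBounded.exists_norm_le
  refine EntireDynamics.mem_fatouSet_of_bounded hh.1 (M := M)
    (mem_of_superset (hf_open.image_mem_nhds hzS) ?_)
  rintro _ ⟨x, hx, rfl⟩ n
  have hsemi : Function.Semiconj f g h := fun x => congrFun hfgh x
  rw [← (hsemi.iterate_right n) x]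
  exact hM _ (mem_image_of_mem f (hx n))
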